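/- Let $H$ be a complex Hilbert space and let $A \subseteq B(H)$ be a Jordan operator algebra, that is, a norm-closed linear subspace that is closed under the Jordan product $a \circ b = \frac12(ab+ba)$ ($A$ need not have an identity or an approximate identity). For a linear subspace $S \subseteq B(H)$ write $\Delta(S) = S \cap S^* = \{x \in S : x^* \in S\}$. Let $P : A \to A$ be a linear map with $P \circ P = P$ and $\|P(x)\| \le \|x\|$ for all $x \in A$, which is real positive: if $x \in A$ and $\frac12(x + x^*) \ge 0$, then $\frac12(P(x) + P(x)^*) \ge 0$. Then $\Delta(A)$ is a $JC^*$-algebra (a Jordan operator algebra closed under the involution of $B(H)$), the restriction of $P$ to $\Delta(A)$ is positive, that is, $P(x) \ge 0$ for every $x \in \Delta(A)$ with $x \ge 0$, and $$P(\Delta(A)) = \Delta(P(A)) = \Delta(A) \cap P(A).$$ -/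

import Mathlib

namespace JordanOA

variable {H : Type*} [NormedAddCommGroup H] [InnerProductSpace ℂ H] [CompleteSpace H]

/-- The Jordan product `a ∘ b = (ab + ba) / 2` on `B(H)`. -/
noncomputable def jordanProduct (a b : H →L[ℂ] H) : H →L[ℂ] H :=
  (2⁻¹ : ℂ) • (a * b + b * a)

/-- A Jordan operator algebra on `H`: a norm-closed linear subspace of `B(H)` which is closed
under the Jordan product. No identity or approximate identity is required. -/
structure IsJordanOperatorAlgebra (A : Submodule ℂ (H →L[ℂ] H)) : Prop where
  isClosed : IsClosed (A : Set (H →L[ℂ] H))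
  jordanProduct_mem : ∀ a ∈ A, ∀ b ∈ A, jordanProduct a b ∈ A

/-- A `JC*`-algebra on `H`: a Jordan operator algebra which is closed under the involution
of `B(H)`. -/
structure IsJCStarAlgebra (A : Submodule ℂ (H →L[ℂ] H)) : Prop
    extends IsJordanOperatorAlgebra A where
  star_mem : ∀ a ∈ A, star a ∈ A

/-- The diagonal `Δ(S) = S ∩ S*` of a linear subspace `S` of `B(H)`. -/
def diagonal (S : Submodule ℂ (H →L[ℂ] H)) : Submodule ℂ (H →L[ℂ] H) where
  carrier := {x | x ∈ S ∧ star x ∈ S}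
  add_mem' := fun {x y} hx hy => ⟨S.add_mem hx.1 hy.1, by
    rw [star_add]; exact S.add_mem hx.2 hy.2⟩
  zero_mem' := ⟨S.zero_mem, by rw [star_zero]; exact S.zero_mem⟩
  smul_mem' := fun c x hx => ⟨S.smul_mem c hx.1, by
    rw [star_smul]; exact S.smul_mem (star c) hx.2⟩

/-- An operator `T` is real positive (accretive) if its real part `(T + T*) / 2` is a positive
operator. -/
def IsRealPositive (T : H →L[ℂ] H) : Prop :=
  ((2⁻¹ : ℂ) • (T + star T)).IsPositive

/-- A linear map `P : A → A` is real positive if it maps the real positive elements of `A` to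
real positive elements. -/
def IsRealPositiveMap {A : Submodule ℂ (H →L[ℂ] H)} (P : A →ₗ[ℂ] A) : Prop :=
  ∀ x : A, IsRealPositive (x : H →L[ℂ] H) → IsRealPositive (P x : H →L[ℂ] H)

/-- The image `P(S) = {P x : x ∈ A ∩ S}`, as a linear subspace of `B(H)`. For `S ≤ A` this is
the usual image of `S`. -/
def image {A : Submodule ℂ (H →L[ℂ] H)} (P : A →ₗ[ℂ] A) (S : Submodule ℂ (H →L[ℂ] H)) :
    Submodule ℂ (H →L[ℂ] H) :=
  (S.comap A.subtype).map (A.subtype ∘ₗ P)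

end JordanOA

namespace JordanOA

variable {H : Type*} [NormedAddCommGroup H] [InnerProductSpace ℂ H]

/-! Skew-adjoint operators are exactly those `T` with both `T` and `-T` real positive. So `P`
preserves skew-adjointness and, by complex linearity, self-adjointness; hence it commutes with the
involution on `Δ(A)` (`IsRealPositiveMap.star_apply`). For self-adjoint operators real positive
means positive, which gives positivity of `P`. The equalities come from the cycle `P(Δ(A)) ⊆ Δ(P(A))
⊆ Δ(A) ∩ P(A) ⊆ P(Δ(A))`. -/

lemma mem_image {A : Submodule ℂ (H →L[ℂ] H)} {P : A →ₗ[ℂ] A} {S : Submodule ℂ (H →L[ℂ] H)}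
    {y : H →L[ℂ] H} :
    y ∈ image P S ↔ ∃ a : A, (a : H →L[ℂ] H) ∈ S ∧ (P a : H →L[ℂ] H) = y := by
  simp only [image, Submodule.mem_map, Submodule.mem_comap, LinearMap.comp_apply,
    Submodule.subtype_apply]

variable [CompleteSpace H]

lemma star_jordanProduct (a b : H →L[ℂ] H) :
    star (jordanProduct a b) = jordanProduct (star a) (star b) := by
  simp [jordanProduct, star_smul, add_comm]

lemma isJCStarAlgebra_diagonal {A : Submodule ℂ (H →L[ℂ] H)} (hA : IsJordanOperatorAlgebra A) :
    IsJCStarAlgebra (diagonal A) where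
  isClosed := hA.isClosed.inter (hA.isClosed.preimage continuous_star)
  jordanProduct_mem a ha b hb :=
    ⟨hA.jordanProduct_mem a ha.1 b hb.1, by
      rw [star_jordanProduct]
      exact hA.jordanProduct_mem _ ha.2 _ hb.2⟩
  star_mem a ha := ⟨ha.2, by rw [star_star]; exact ha.1⟩

lemma isRealPositive_of_star_eq_neg {T : H →L[ℂ] H} (hT : star T = -T) : IsRealPositive T := by
  simp [IsRealPositive, hT]

/-- If both `T` and `-T` are real positive, then `T` is skew-adjoint. -/
lemma IsRealPositive.star_eq_neg {T : H →L[ℂ] H} (h : IsRealPositive T)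
    (h' : IsRealPositive (-T)) : star T = -T := by
  have h1 : 0 ≤ (2⁻¹ : ℂ) • (T + star T) := (ContinuousLinearMap.nonneg_iff_isPositive _).2 h
  have h2 : 0 ≤ (2⁻¹ : ℂ) • (-T + star (-T)) :=
    (ContinuousLinearMap.nonneg_iff_isPositive _).2 h'
  rw [star_neg, ← neg_add, smul_neg, neg_nonneg] at h2
  have h3 := (smul_eq_zero.1 (le_antisymm h2 h1)).resolve_left (by norm_num)
  exact eq_neg_of_add_eq_zero_right h3

lemma isRealPositive_iff_of_isSelfAdjoint {T : H →L[ℂ] H} (hT : IsSelfAdjoint T) :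
    IsRealPositive T ↔ T.IsPositive := by
  have : (2⁻¹ : ℂ) • (T + star T) = T := by
    rw [hT.star_eq, ← two_smul ℂ T, smul_smul, inv_mul_cancel₀ two_ne_zero, one_smul]
  rw [IsRealPositive, this]

/-- A real positive linear map preserves self-adjointness. -/
lemma IsRealPositiveMap.isSelfAdjoint {A : Submodule ℂ (H →L[ℂ] H)} {P : A →ₗ[ℂ] A}
    (hP : IsRealPositiveMap P) {x : A} (hx : IsSelfAdjoint (x : H →L[ℂ] H)) :
    IsSelfAdjoint (P x : H →L[ℂ] H) := by
  -- Multiplying by `i` makes `x` skew-adjoint, so `±ix` are both real positive.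
  have h1 : IsRealPositive (Complex.I • (P x : H →L[ℂ] H)) := by
    have := hP (Complex.I • x) (isRealPositive_of_star_eq_neg (by simp [star_smul, hx.star_eq]))
    simpa using this
  have h2 : IsRealPositive (-(Complex.I • (P x : H →L[ℂ] H))) := by
    have := hP (-(Complex.I • x))
      (isRealPositive_of_star_eq_neg (by simp [star_smul, hx.star_eq]))
    simpa using this
  have h3 := h1.star_eq_neg h2
  rw [star_smul, Complex.star_def, Complex.conj_I, neg_smul, neg_inj] at h3
  exact smul_right_injective _ Complex.I_ne_zero h3

/-- A real positive linear map commutes with the involution on the diagonal. -/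
lemma IsRealPositiveMap.star_apply {A : Submodule ℂ (H →L[ℂ] H)} {P : A →ₗ[ℂ] A}
    (hP : IsRealPositiveMap P) {x y : A} (hxy : (y : H →L[ℂ] H) = star (x : H →L[ℂ] H)) :
    star (P x : H →L[ℂ] H) = P y := by
  -- `x + y` and `i(x - y)` are, up to real factors, the real and imaginary parts of `x`.
  have h1 := (hP.isSelfAdjoint (x := x + y) (by
    rw [isSelfAdjoint_iff]; simp [hxy, add_comm])).star_eq
  have h2 := (hP.isSelfAdjoint (x := Complex.I • (x - y)) (by
    rw [isSelfAdjoint_iff]; simp [hxy, star_smul, smul_sub, neg_add_eq_sub])).star_eq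
  simp only [map_add, map_smul, map_sub, Submodule.coe_add, Submodule.coe_smul, Submodule.coe_sub,
    star_add, star_sub, star_smul, Complex.star_def, Complex.conj_I, neg_smul, ← smul_neg] at h1 h2
  have h3 := smul_right_injective _ Complex.I_ne_zero h2
  have h4 : (2 : ℂ) • star (P x : H →L[ℂ] H) = (2 : ℂ) • (P y : H →L[ℂ] H) := by
    calc (2 : ℂ) • star (P x : H →L[ℂ] H)
        = (star (P x : H →L[ℂ] H) + star (P y : H →L[ℂ] H))
          - -(star (P x : H →L[ℂ] H) - star (P y : H →L[ℂ] H)) := by module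
      _ = (P x + P y : H →L[ℂ] H) - (P x - P y : H →L[ℂ] H) := congrArg₂ _ h1 h3
      _ = (2 : ℂ) • (P y : H →L[ℂ] H) := by module
  exact smul_right_injective _ two_ne_zero h4

end JordanOA

theorem proposition5p5 {H : Type*} [NormedAddCommGroup H] [InnerProductSpace ℂ H]
    [CompleteSpace H] (A : Submodule ℂ (H →L[ℂ] H)) (hA : JordanOA.IsJordanOperatorAlgebra A)
    (P : A →ₗ[ℂ] A) (hproj : ∀ x : A, P (P x) = P x) (hcontr : ∀ x : A, ‖P x‖ ≤ ‖x‖)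
    (hpos : JordanOA.IsRealPositiveMap P) :
    JordanOA.IsJCStarAlgebra (JordanOA.diagonal A) ∧
    (∀ x : A, (x : H →L[ℂ] H) ∈ JordanOA.diagonal A → (x : H →L[ℂ] H).IsPositive →
      (P x : H →L[ℂ] H).IsPositive) ∧
    JordanOA.image P (JordanOA.diagonal A) = JordanOA.diagonal (JordanOA.image P A) ∧
    JordanOA.diagonal (JordanOA.image P A) = JordanOA.diagonal A ⊓ JordanOA.image P A := by
  have hstar : ∀ x : A, (x : H →L[ℂ] H) ∈ JordanOA.diagonal A →
      ∃ y : A, (y : H →L[ℂ] H) ∈ JordanOA.diagonal A ∧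
        (P y : H →L[ℂ] H) = star (P x : H →L[ℂ] H) := fun x hx =>
    ⟨⟨_, hx.2⟩, (JordanOA.isJCStarAlgebra_diagonal hA).star_mem _ hx,
      (hpos.star_apply (y := ⟨_, hx.2⟩) rfl).symm⟩
  have hle : JordanOA.image P (JordanOA.diagonal A) ≤ JordanOA.diagonal (JordanOA.image P A) := by
    intro z hz
    obtain ⟨x, hx, rfl⟩ := JordanOA.mem_image.1 hz
    obtain ⟨y, -, hPy⟩ := hstar x hx
    exact ⟨JordanOA.mem_image.2 ⟨x, x.2, rfl⟩, JordanOA.mem_image.2 ⟨y, y.2, hPy⟩⟩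
  have hle' : JordanOA.diagonal (JordanOA.image P A) ≤
      JordanOA.diagonal A ⊓ JordanOA.image P A := by
    rintro z ⟨hz, hz'⟩
    obtain ⟨a, -, ha⟩ := JordanOA.mem_image.1 hz
    obtain ⟨b, -, hb⟩ := JordanOA.mem_image.1 hz'
    exact ⟨⟨ha ▸ (P a).2, hb ▸ (P b).2⟩, hz⟩
  have hge : JordanOA.diagonal A ⊓ JordanOA.image P A ≤
      JordanOA.image P (JordanOA.diagonal A) := by
    rintro z ⟨hz, hz'⟩
    obtain ⟨a, -, rfl⟩ := JordanOA.mem_image.1 hz'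
    -- Idempotence fixes elements of the range, so the element is its own preimage, and it lies in
    -- `Δ(A)`.
    exact JordanOA.mem_image.2 ⟨P a, hz, by rw [hproj]⟩
  refine ⟨JordanOA.isJCStarAlgebra_diagonal hA, fun x _ hx => ?_,
    le_antisymm hle (hle'.trans hge), le_antisymm hle' (hge.trans hle)⟩
  have hsa := hx.isSelfAdjoint
  exact (JordanOA.isRealPositive_iff_of_isSelfAdjoint (hpos.isSelfAdjoint hsa)).1
    (hpos x ((JordanOA.isRealPositive_iff_of_isSelfAdjoint hsa).2 hx))
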